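/- Let $I=(0,1)$, $T>0$, and let $L:\mathbb R\to\mathbb R$ be nondecreasing with a jump at $0$ of size $J:=L(0^+)-L(0^-)>0$ (the model case is $L(p)=\operatorname{sgn}p+L_r(p)$ with $L_r\in C^1$, $L_r'\ge 0$, for which $J=2$); $L$ is understood as the multivalued monotone graph $L(p)=[L(p^-),L(p^+)]$. Let $f$ be smooth on $[0,1]\times[0,T]$. Let $u$ be a weak solution of $$u_t-\partial_xL(u_x)=f\ \text{ in } I\times(0,T),\qquad u(0,t)=u(1,t)=0,\qquad u|_{t=0}=u_0,$$ with $u_x\in L_\infty(0,T;BV(I))$ and $u_t\in L_\infty(\delta,T;L_2(I))$ for every $\delta>0$; that is, there is an integrable $\sigma$ on $I\times (0,T)$ with $\sigma\in L(u_x)$ a.e. such that $u_t-\partial_x\sigma=f$ with $u|_{t=0}=u_0$ in the sense of distributions on $I\times[0,T)$. Here $u$ denotes the representative that is continuous on $[0,1]\times[0,T]$. For $x_0\in[0,1]$ the plateau of $u(\cdot,t)$ through $x_0$ is the largest interval $[a,b]\subseteq[0,1]$ containing $x_0$ on which $u(\cdot,t)=u(x_0,t)$. It is called extremal if $0<a\le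 b<1$ and $u(\cdot,t)\le u(x_0,t)$ on a neighbourhood of $[a,b]$, or $u(\cdot,t)\ge u(x_0,t)$ on a neighbourhood of $[a,b]$. (i) For every $t\in(0,T]$ and every local extremum $x_0\in(0,1)$ of $u(\cdot,t)$, the plateau $[a,b]$ of $u(\cdot,t)$ through $x_0$ is non-degenerate: $a<b$. (ii) For a.e. $t\in(0,T)$, every extremal plateau $[a,b]$ of $u(\cdot,t)$ satisfies $$b-a\ \ge\ \Big(\frac{J}{\|f(\cdot,t)\|_{L_\infty(I)}+\|u_t(\cdot,t)\|_{L_2(I)}}\Big)^2,$$ and, if $u_t(\cdot,t)\in L_\infty(I)$, also $$b-a\ \ge\ \frac{J}{\|f(\cdot,t)\|_{L_\infty(I)}+\|u_t(\cdot,t)\|_{L_\infty(I)}}.$$ (iii) Let $t\in(0,T]$, let $t_1<t_2$ with $0\le t_1\le t\le t_2\le T$, and let $M\ge 0$. If $\|u_t(\cdot,s)\|_{L_2(I)}\le M$ for a.e. $s\in(t_1,t_2)$, then every extremal plateau $[a,b]$ of $u(\cdot,t)$ satisfies $b-a\ge \big(J/(\|f(\cdot,t)\|_{L_\infty(I)}+M)\big)^2$.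 If $\|u_t(\cdot,s)\|_{L_\infty(I)}\le M$ for a.e. $s\in(t_1,t_2)$, then every such plateau satisfies $b-a\ge J/(\|f(\cdot,t)\|_{L_\infty(I)}+M)$. In (ii) and (iii) the denominators are positive whenever an extremal plateau exists. -/

import Mathlib

open MeasureTheory Set Filter Topology
open scoped ENNReal NNReal ContDiff

noncomputable section

namespace Facet

/-- The maximal monotone graph obtained from a nondecreasing function `L` by filling in its
jumps: `L(p) = [L(p-), L(p+)]`. For `L = sgn` one gets `[-1, 1]` at `p = 0`. -/
def graph (L : ℝ → ℝ) (p : ℝ) : Set ℝ :=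
  Icc (Function.leftLim L p) (Function.rightLim L p)

/-- The size `L(0+) - L(0-)` of the jump at `0`; it is `2` for `L(p) = sgn p + L_r(p)` with
`L_r` continuous. -/
def jump (L : ℝ → ℝ) : ℝ := Function.rightLim L 0 - Function.leftLim L 0

/-- The spatial interval `I = (0, 1)`. -/
def I : Set ℝ := Ioo 0 1

/-- Lebesgue measure on `I`. -/
def volI : Measure ℝ := volume.restrict I

/-- The space-time cylinder; points are `(t, x)`. -/
def Q (T : ℝ) : Set (ℝ × ℝ) := Ioo 0 T ×ˢ I

/-- `‖g‖_{L_q(I)}`, with values in `[0, ∞]`. -/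
def normI (g : ℝ → ℝ) (q : ℝ≥0∞) : ℝ≥0∞ := eLpNorm g q volI

/-- Total variation on `I` of the a.e.-equivalence class of `g`. -/
def essVariation (g : ℝ → ℝ) : ℝ≥0∞ :=
  ⨅ (h : ℝ → ℝ) (_ : h =ᵐ[volI] g), eVariationOn h I

/-- The norm of `BV(I)`. -/
def bvNorm (g : ℝ → ℝ) : ℝ≥0∞ := normI g 1 + essVariation g

/-- Partial derivative in the time variable. -/
def dt (φ : ℝ × ℝ → ℝ) (z : ℝ × ℝ) : ℝ := deriv (fun s => φ (s, z.2)) z.1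

/-- Partial derivative in the space variable. -/
def dx (φ : ℝ × ℝ → ℝ) (z : ℝ × ℝ) : ℝ := deriv (fun y => φ (z.1, y)) z.2

/-- Smooth functions with compact support contained in `U`. -/
def IsTest (U : Set (ℝ × ℝ)) (φ : ℝ × ℝ → ℝ) : Prop :=
  ContDiff ℝ ∞ φ ∧ HasCompactSupport φ ∧ tsupport φ ⊆ U

/-- `u` (continuous representative, `u t x = u(x, t)`) is a weak solution on `I × (0, T)` of
`u_t - ∂_x L(u_x) = f`, `u(0, t) = u(1, t) = 0`, `u|_{t=0} = u₀`, in the class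
`u_x ∈ L_∞(0, T; BV(I))`, `u_t ∈ L_∞(δ, T; L_2(I))` for all `δ > 0`, where
`ux`, `ut` are its weak derivatives and `σ ∈ L(u_x)` is the flux. -/
structure IsSolution (L : ℝ → ℝ) (f : ℝ → ℝ → ℝ) (u₀ : ℝ → ℝ) (T : ℝ)
    (u ux ut σ : ℝ → ℝ → ℝ) : Prop where
  continuousOn : ContinuousOn (Function.uncurry u) (Icc 0 T ×ˢ Icc 0 1)
  initial : ∀ x ∈ Icc (0 : ℝ) 1, u 0 x = u₀ x
  boundary : ∀ t ∈ Icc 0 T, u t 0 = 0 ∧ u t 1 = 0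
  ux_integrable : IntegrableOn (Function.uncurry ux) (Q T)
  ux_weak : ∀ φ, IsTest (Q T) φ →
    ∫ z in Q T, Function.uncurry u z * dx φ z = - ∫ z in Q T, Function.uncurry ux z * φ z
  ux_bv : ∃ C : ℝ≥0, ∀ᵐ t ∂(volume.restrict (Ioo 0 T)), bvNorm (ux t) ≤ C
  ut_measurable : AEStronglyMeasurable (Function.uncurry ut) (volume.restrict (Q T))
  ut_weak : ∀ φ, IsTest (Q T) φ →
    ∫ z in Q T, Function.uncurry u z * dt φ z = - ∫ z in Q T, Function.uncurry ut z * φ z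
  ut_bound : ∀ δ > 0, ∃ C : ℝ≥0, ∀ᵐ t ∂(volume.restrict (Ioo δ T)), normI (ut t) 2 ≤ C
  flux_integrable : IntegrableOn (Function.uncurry σ) (Q T)
  flux_mem : ∀ᵐ z ∂(volume.restrict (Q T)),
    Function.uncurry σ z ∈ graph L (Function.uncurry ux z)
  /-- The equation, tested with smooth functions that need not vanish at `t = 0`. -/
  weak_form : ∀ φ, IsTest (Iio T ×ˢ I) φ →
    - (∫ z in Q T, Function.uncurry u z * dt φ z) - (∫ x in I, u₀ x * φ (0, x))
      + (∫ z in Q T, Function.uncurry σ z * dx φ z)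
      = ∫ z in Q T, Function.uncurry f z * φ z

/-- `[a, b]` is the largest subinterval of `[0, 1]` that contains `x₀` and on which
`v = v x₀`. -/
def IsPlateau (v : ℝ → ℝ) (x₀ a b : ℝ) : Prop :=
  0 ≤ a ∧ b ≤ 1 ∧ x₀ ∈ Icc a b ∧ (∀ x ∈ Icc a b, v x = v x₀) ∧
    ∀ a' b', 0 ≤ a' → b' ≤ 1 → x₀ ∈ Icc a' b' → (∀ x ∈ Icc a' b', v x = v x₀) →
      a ≤ a' ∧ b' ≤ b

/-- `[a, b] ⊆ (0, 1)` (possibly `a = b`) is a maximal interval of constancy of `v`, and `v` has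
a local extremum along it: in a neighbourhood of `[a, b]`, `v` stays on one side of its value
on `[a, b]`. -/
def IsExtremalPlateau (v : ℝ → ℝ) (a b : ℝ) : Prop :=
  0 < a ∧ b < 1 ∧ IsPlateau v a a b ∧
    ((∀ᶠ x in 𝓝ˢ (Icc a b), v x ≤ v a) ∨ (∀ᶠ x in 𝓝ˢ (Icc a b), v a ≤ v x))

end Facet

end

/-!
At almost every time the weak formulation can be sliced: `u` is a primitive of its slope `ux`, and
the flux `σ` agrees almost everywhere with a primitive `S` of `ut - f`
(`IsSolution.ae_isFluxSlice`). The exceptional null set of times is independent of the test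
function because the test functions are separable in `C¹`; each slice is then settled by the lemma
of du Bois-Reymond.

At such a time, let `u` have a maximum on `[a, b]` with strictly smaller values at some `c < a` and
`d > b`. Then `ux > 0` on a set of positive measure in `(c, a)`, where monotonicity of `L` forces
`S ≥ L(0+)`, and `ux < 0` on a set of positive measure in `(b, d)`, where `S ≤ L(0-)`. Hence `S`
varies by at least the jump between two points of `(c, d)` (`IsFluxSlice.exists_jump_le`), while
its increment is the integral of `ut - f` between them, at most a constant times `√(d - c)` or
`d - c`.

The strict inequalities at `c` and `d` involve only the continuous function `u`, so they are stable
in time. This gives the bound at every positive time, not only at almost every one: for fixed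
`c` and `d`, use a time `s` near `t` at which the slice has a flux and `ut` obeys its bound, and
afterwards let `c → a` and `d → b` (`jump_le_of_frequently`). Since the jump is positive, the
limiting inequality excludes `a = b`.
-/

namespace Facet

/-! ### Weak derivatives in one space variable -/

/-- Smooth functions of one variable with compact support contained in `U`, the one-dimensional
counterpart of `IsTest`. -/
def IsTest₁ (U : Set ℝ) (ψ : ℝ → ℝ) : Prop :=
  ContDiff ℝ ∞ ψ ∧ HasCompactSupport ψ ∧ tsupport ψ ⊆ U

namespace IsTest₁

variable {U : Set ℝ} {ψ : ℝ → ℝ}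

theorem continuous (hψ : IsTest₁ U ψ) : Continuous ψ := hψ.1.continuous

theorem continuous_deriv (hψ : IsTest₁ U ψ) : Continuous (deriv ψ) :=
  hψ.1.continuous_deriv (by simp)

theorem eq_zero (hψ : IsTest₁ U ψ) {x : ℝ} (hx : x ∉ U) : ψ x = 0 :=
  image_eq_zero_of_notMem_tsupport fun h => hx (hψ.2.2 h)

theorem exists_abs_le (hψ : IsTest₁ U ψ) : ∃ C, ∀ x, |ψ x| ≤ C := by
  obtain ⟨C, hC⟩ := hψ.2.1.exists_bound_of_continuous hψ.continuous
  exact ⟨C, hC⟩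

theorem exists_abs_deriv_le (hψ : IsTest₁ U ψ) : ∃ C, ∀ x, |deriv ψ x| ≤ C := by
  obtain ⟨C, hC⟩ := hψ.2.1.deriv.exists_bound_of_continuous hψ.continuous_deriv
  exact ⟨C, hC⟩

end IsTest₁

theorem measurableSet_I : MeasurableSet I := measurableSet_Ioo

theorem intervalIntegrable_of_integrableOn_I {g : ℝ → ℝ} (hg : IntegrableOn g I) {a b : ℝ}
    (ha : a ∈ Icc (0 : ℝ) 1) (hb : b ∈ Icc (0 : ℝ) 1) : IntervalIntegrable g volume a b := by
  have h : IntervalIntegrable g volume 0 1 := by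
    rw [intervalIntegrable_iff_integrableOn_Ioo_of_le zero_le_one]
    exact hg
  refine h.mono_set ?_
  rw [uIcc_of_le zero_le_one]
  exact uIcc_subset_Icc ha hb

theorem continuousOn_primitive_I {g : ℝ → ℝ} (hg : IntegrableOn g I) :
    ContinuousOn (fun x => ∫ y in (0 : ℝ)..x, g y) (Icc 0 1) := by
  have h := (intervalIntegrable_of_integrableOn_I hg (a := 0) (b := 1) (by simp)
    (by simp)).absolutelyContinuousOnInterval_intervalIntegral (c := 0) (by simp)
  simpa [uIcc_of_le (zero_le_one' ℝ)] using h.continuousOn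

theorem integral_primitive_mul_deriv {g ψ : ℝ → ℝ} (hg : IntegrableOn g I)
    (hψ : IsTest₁ I ψ) :
    ∫ x in I, (∫ y in (0 : ℝ)..x, g y) * deriv ψ x = - ∫ x in I, g x * ψ x := by
  have hg' := intervalIntegrable_of_integrableOn_I hg (a := 0) (b := 1) (by simp) (by simp)
  have hG := hg'.absolutelyContinuousOnInterval_intervalIntegral (c := 0) (by simp)
  have hψ' : AbsolutelyContinuousOnInterval ψ 0 1 :=
    (hψ.1.contDiffOn.of_le (by simp)).absolutelyContinuousOnInterval
  have key := hG.integral_mul_deriv_eq_deriv_mul hψ'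
  have h0 : ψ 0 = 0 := hψ.eq_zero (by simp [I])
  have h1 : ψ 1 = 0 := hψ.eq_zero (by simp [I])
  have hcongr : ∫ x in (0 : ℝ)..1, deriv (fun x => ∫ y in (0 : ℝ)..x, g y) x * ψ x
      = ∫ x in (0 : ℝ)..1, g x * ψ x := by
    apply intervalIntegral.integral_congr_ae
    filter_upwards [hg'.ae_hasDerivAt_integral] with x hx hx'
    rw [(hx (uIoc_subset_uIcc hx') 0 (by simp)).deriv]
  rw [hcongr, h0, h1] at key
  simpa [I, intervalIntegral.integral_of_le, integral_Ioc_eq_integral_Ioo] using key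

theorem exists_isTest₁_integral_eq_one : ∃ ψ, IsTest₁ I ψ ∧ ∫ x, ψ x = 1 := by
  let b : ContDiffBump (1 / 2 : ℝ) := ⟨1 / 8, 1 / 4, by norm_num, by norm_num⟩
  refine ⟨b.normed volume, ⟨b.contDiff_normed, b.hasCompactSupport_normed, ?_⟩,
    b.integral_normed⟩
  rw [b.tsupport_normed_eq]
  intro x hx
  rw [Real.closedBall_eq_Icc] at hx
  simp only [b, mem_Icc] at hx
  constructor <;> linarith [hx.1, hx.2]

/-- A test function of mean zero is the derivative of a test function. -/
theorem IsTest₁.exists_deriv_eq {θ : ℝ → ℝ} (hθ : IsTest₁ I θ) (h0 : ∫ x, θ x = 0) :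
    ∃ χ, IsTest₁ I χ ∧ deriv χ = θ := by
  have hd : ∀ x, HasDerivAt (fun x => ∫ y in (0 : ℝ)..x, θ y) (θ x) x := fun x =>
    intervalIntegral.integral_hasDerivAt_right (hθ.continuous.intervalIntegrable _ _)
      (hθ.continuous.stronglyMeasurableAtFilter _ _) hθ.continuous.continuousAt
  have hderiv : deriv (fun x => ∫ y in (0 : ℝ)..x, θ y) = θ := funext fun x => (hd x).deriv
  obtain ⟨α, β, hα, hβ, hsub⟩ : ∃ α β : ℝ, 0 < α ∧ β < 1 ∧ tsupport θ ⊆ Icc α β := by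
    rcases (tsupport θ).eq_empty_or_nonempty with he | hne
    · exact ⟨1 / 2, 1 / 2, by norm_num, by norm_num, by simp [he]⟩
    · obtain ⟨α, hα⟩ := hθ.2.1.isCompact.exists_isLeast hne
      obtain ⟨β, hβ⟩ := hθ.2.1.isCompact.exists_isGreatest hne
      exact ⟨α, β, (hθ.2.2 hα.1).1, (hθ.2.2 hβ.1).2, fun x hx => ⟨hα.2 hx, hβ.2 hx⟩⟩
  have hz : ∀ x ∉ Icc α β, θ x = 0 := fun x hx =>
    image_eq_zero_of_notMem_tsupport fun h => hx (hsub h)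
  have hsupp : ∀ x ∉ Icc α β, ∫ y in (0 : ℝ)..x, θ y = 0 := by
    intro x hx
    rcases lt_or_ge x α with h | h
    · refine intervalIntegral.integral_zero_ae (Eventually.of_forall fun y hy => hz y ?_)
      intro hy'
      have h1 : y ≤ max 0 x := hy.2
      have h2 : max 0 x < α := max_lt hα h
      linarith [hy'.1]
    · have hx' : β < x := by
        by_contra hb
        exact hx ⟨h, not_lt.1 hb⟩
      rw [intervalIntegral.integral_eq_integral_of_support_subset, h0]
      intro y hy
      have : y ∈ Icc α β := by
        by_contra hy'
        exact hy (hz y hy')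
      exact ⟨hα.trans_le this.1, this.2.trans hx'.le⟩
  have hts : tsupport (fun x => ∫ y in (0 : ℝ)..x, θ y) ⊆ Icc α β := by
    refine closure_minimal (fun x hx => ?_) isClosed_Icc
    by_contra h
    exact hx (hsupp x h)
  refine ⟨_, ⟨?_, isCompact_Icc.of_isClosed_subset (isClosed_tsupport _) hts,
    hts.trans fun x hx => ⟨hα.trans_le hx.1, hx.2.trans_lt hβ⟩⟩, hderiv⟩
  rw [contDiff_infty_iff_deriv, hderiv]
  exact ⟨fun x => (hd x).differentiableAt, hθ.1⟩

theorem IsTest₁.integrableOn_mul {h ψ : ℝ → ℝ} (hh : IntegrableOn h I) (hψ : IsTest₁ I ψ) :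
    IntegrableOn (fun x => h x * ψ x) I := by
  obtain ⟨C, hC⟩ := hψ.exists_abs_le
  exact Integrable.mul_bdd hh hψ.continuous.aestronglyMeasurable (Eventually.of_forall hC)

theorem IsTest₁.integrableOn_mul_deriv {h ψ : ℝ → ℝ} (hh : IntegrableOn h I)
    (hψ : IsTest₁ I ψ) : IntegrableOn (fun x => h x * deriv ψ x) I := by
  obtain ⟨C, hC⟩ := hψ.exists_abs_deriv_le
  exact Integrable.mul_bdd hh hψ.continuous_deriv.aestronglyMeasurable
    (Eventually.of_forall hC)

/-- The lemma of du Bois-Reymond. -/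
theorem ae_eq_const_of_integral_mul_deriv_eq_zero {h : ℝ → ℝ} (hh : IntegrableOn h I)
    (H : ∀ ψ, IsTest₁ I ψ → ∫ x in I, h x * deriv ψ x = 0) :
    ∃ c, ∀ᵐ x ∂volI, h x = c := by
  obtain ⟨ψ₀, hψ₀, h1⟩ := exists_isTest₁_integral_eq_one
  set c := ∫ x in I, h x * ψ₀ x with hc
  have hI : IntegrableOn (fun _ : ℝ => c) I := by
    simp [I, integrableOn_const_iff]
  refine ⟨c, ?_⟩
  have key : ∀ᵐ x ∂(volume : Measure ℝ), x ∈ I → h x - c = 0 := by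
    refine isOpen_Ioo.ae_eq_zero_of_integral_contDiff_smul_eq_zero (f := fun x => h x - c)
      (hh.sub hI).locallyIntegrableOn fun g g1 g2 g3 => ?_
    have hg : IsTest₁ I g := ⟨g1, g2, g3⟩
    have hgi : Integrable g := g1.continuous.integrable_of_hasCompactSupport g2
    have hψi : Integrable ψ₀ := hψ₀.continuous.integrable_of_hasCompactSupport hψ₀.2.1
    -- subtracting a multiple of `ψ₀` from `g` makes the mean vanish
    have hθ : IsTest₁ I (g - fun x => (∫ y, g y) * ψ₀ x) := by
      refine ⟨g1.sub (contDiff_const.mul hψ₀.1), ?_, ?_⟩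
      · exact g2.sub hψ₀.2.1.mul_left
      · refine (tsupport_sub _ _).trans (union_subset g3 ?_)
        exact (tsupport_mul_subset_right).trans hψ₀.2.2
    have hθ0 : ∫ x, (g - fun x => (∫ y, g y) * ψ₀ x) x = 0 := by
      simp only [Pi.sub_apply]
      rw [integral_sub hgi (hψi.const_mul _), integral_const_mul, h1]
      ring
    obtain ⟨χ, hχ, hχ'⟩ := hθ.exists_deriv_eq hθ0
    have e := H χ hχ
    rw [hχ'] at e
    have e1 : ∫ x in I, h x * (g - fun x => (∫ y, g y) * ψ₀ x) x
        = (∫ x in I, h x * g x) - (∫ y, g y) * c := by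
      rw [hc, ← integral_const_mul, ← integral_sub (hg.integrableOn_mul hh)
        ((hψ₀.integrableOn_mul hh).const_mul _)]
      refine integral_congr_ae (Eventually.of_forall fun x => ?_)
      simp only [Pi.sub_apply]
      ring
    have e2 : ∫ x in I, g x = ∫ x, g x :=
      setIntegral_eq_integral_of_forall_compl_eq_zero fun x hx => hg.eq_zero hx
    rw [← setIntegral_eq_integral_of_forall_compl_eq_zero (s := I)
      (fun x hx => by rw [hg.eq_zero hx, zero_smul])]
    have e3 : ∫ x in I, g x • (h x - c) = (∫ x in I, h x * g x) - (∫ x in I, g x) * c := by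
      rw [← integral_mul_const, ← integral_sub (hg.integrableOn_mul hh)
        (hgi.integrableOn.mul_const _)]
      refine integral_congr_ae (Eventually.of_forall fun x => ?_)
      simp only [smul_eq_mul]
      ring
    rw [e3, e2, ← e1, e]
  rw [volI, ae_restrict_iff' measurableSet_I]
  filter_upwards [key] with x hx hxI
  linarith [hx hxI]

/-- A function on `I` with an integrable weak derivative is almost everywhere equal to a
primitive of that derivative. -/
theorem ae_eq_add_primitive {p q : ℝ → ℝ} (hp : IntegrableOn p I) (hq : IntegrableOn q I)
    (H : ∀ ψ, IsTest₁ I ψ → ∫ x in I, p x * deriv ψ x = - ∫ x in I, q x * ψ x) :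
    ∃ c, ∀ᵐ x ∂volI, p x = c + ∫ y in (0 : ℝ)..x, q y := by
  have hG : IntegrableOn (fun x => ∫ y in (0 : ℝ)..x, q y) I :=
    ((continuousOn_primitive_I hq).integrableOn_compact isCompact_Icc).mono_set Ioo_subset_Icc_self
  obtain ⟨c, hc⟩ := ae_eq_const_of_integral_mul_deriv_eq_zero (hp.sub hG) fun ψ hψ => by
    simp only [Pi.sub_apply, sub_mul]
    rw [integral_sub (hψ.integrableOn_mul_deriv hp) (hψ.integrableOn_mul_deriv hG), H ψ hψ,
      integral_primitive_mul_deriv hq hψ, sub_self]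
  refine ⟨c, ?_⟩
  filter_upwards [hc] with x hx
  simp only [Pi.sub_apply] at hx
  linarith

/-- The test functions on `I` are separable in the `C¹` norm. -/
theorem exists_countable_isTest₁_dense :
    ∃ D : Set (ℝ → ℝ), D.Countable ∧ (∀ χ ∈ D, IsTest₁ I χ) ∧
      ∀ ψ, IsTest₁ I ψ → ∀ ε > 0, ∃ χ ∈ D, ∀ x ∈ I,
        |χ x - ψ x| ≤ ε ∧ |deriv χ x - deriv ψ x| ≤ ε := by
  let F : {ψ // IsTest₁ I ψ} → C(Icc (0 : ℝ) 1, ℝ) × C(Icc (0 : ℝ) 1, ℝ) := fun ψ =>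
    (⟨fun x => ψ.1 x, ψ.2.continuous.comp continuous_subtype_val⟩,
      ⟨fun x => deriv ψ.1 x, ψ.2.continuous_deriv.comp continuous_subtype_val⟩)
  obtain ⟨t, htF, htc, hts⟩ :=
    (TopologicalSpace.IsSeparable.of_separableSpace (range F)).exists_countable_dense_subset
  have : Nonempty {ψ // IsTest₁ I ψ} :=
    let ⟨ψ, hψ, _⟩ := exists_isTest₁_integral_eq_one
    ⟨⟨ψ, hψ⟩⟩
  have htF' : ∀ z ∈ t, ∃ ψ, F ψ = z := fun z hz => htF hz
  choose! G hG using htF'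
  refine ⟨(fun z => (G z).1) '' t, htc.image _, ?_, fun ψ hψ ε hε => ?_⟩
  · rintro _ ⟨z, -, rfl⟩
    exact (G z).2
  · obtain ⟨z, hzt, hz⟩ := Metric.mem_closure_iff.1 (hts ⟨⟨ψ, hψ⟩, rfl⟩) ε hε
    refine ⟨_, ⟨z, hzt, rfl⟩, fun x hx => ?_⟩
    rw [← hG z hzt, Prod.dist_eq, max_lt_iff] at hz
    have hx' : x ∈ Icc (0 : ℝ) 1 := Ioo_subset_Icc_self hx
    have h1 := (ContinuousMap.dist_apply_le_dist ⟨x, hx'⟩).trans hz.1.le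
    have h2 := (ContinuousMap.dist_apply_le_dist ⟨x, hx'⟩).trans hz.2.le
    rw [dist_comm] at h1 h2
    exact ⟨h1, h2⟩

/-! ### Weak derivatives on almost every time slice -/

theorem isTest_mul {δ T : ℝ} {η ψ : ℝ → ℝ} (hη : IsTest₁ (Ioo δ T) η) (hψ : IsTest₁ I ψ) :
    IsTest (Ioo δ T ×ˢ I) (fun z => η z.1 * ψ z.2) := by
  have hsub : tsupport (fun z : ℝ × ℝ => η z.1 * ψ z.2) ⊆ tsupport η ×ˢ tsupport ψ := by
    refine closure_minimal (fun z hz => ?_) ((isClosed_tsupport _).prod (isClosed_tsupport _))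
    exact ⟨subset_tsupport _ (left_ne_zero_of_mul hz), subset_tsupport _ (right_ne_zero_of_mul hz)⟩
  exact ⟨(hη.1.comp contDiff_fst).mul (hψ.1.comp contDiff_snd),
    (hη.2.1.isCompact.prod hψ.2.1.isCompact).of_isClosed_subset (isClosed_tsupport _) hsub,
    hsub.trans (prod_mono hη.2.2 hψ.2.2)⟩

theorem volume_restrict_prod_I (δ T : ℝ) :
    (volume : Measure (ℝ × ℝ)).restrict (Ioo δ T ×ˢ I)
      = (volume.restrict (Ioo δ T)).prod (volume.restrict I) := by
  rw [Measure.volume_eq_prod, Measure.prod_restrict]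

/-- If `q` is the weak derivative of `p` in space on a space-time cylinder, then on almost every
time slice `p` is a primitive of `q`. -/
theorem ae_slice_eq_add_primitive {δ T : ℝ} {p q : ℝ → ℝ → ℝ}
    (hp : IntegrableOn (Function.uncurry p) (Ioo δ T ×ˢ I))
    (hq : IntegrableOn (Function.uncurry q) (Ioo δ T ×ˢ I))
    (H : ∀ φ, IsTest (Ioo δ T ×ˢ I) φ →
      ∫ z in Ioo δ T ×ˢ I, Function.uncurry p z * dx φ z
        = - ∫ z in Ioo δ T ×ˢ I, Function.uncurry q z * φ z) :
    ∀ᵐ t ∂(volume.restrict (Ioo δ T)), IntegrableOn (p t) I ∧ IntegrableOn (q t) I ∧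
      ∃ c, ∀ᵐ x ∂volI, p t x = c + ∫ y in (0 : ℝ)..x, q t y := by
  rw [IntegrableOn, volume_restrict_prod_I] at hp hq
  have hsingle : ∀ ψ, IsTest₁ I ψ → ∀ᵐ t ∂(volume.restrict (Ioo δ T)),
      (∫ x in I, p t x * deriv ψ x) + ∫ x in I, q t x * ψ x = 0 := by
    intro ψ hψ
    obtain ⟨C, hC⟩ := hψ.exists_abs_le
    obtain ⟨C', hC'⟩ := hψ.exists_abs_deriv_le
    have ip : Integrable (fun z : ℝ × ℝ => p z.1 z.2 * deriv ψ z.2)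
        ((volume.restrict (Ioo δ T)).prod (volume.restrict I)) :=
      hp.mul_bdd (hψ.continuous_deriv.comp continuous_snd).aestronglyMeasurable
        (Eventually.of_forall fun z => hC' z.2)
    have iq : Integrable (fun z : ℝ × ℝ => q z.1 z.2 * ψ z.2)
        ((volume.restrict (Ioo δ T)).prod (volume.restrict I)) :=
      hq.mul_bdd (hψ.continuous.comp continuous_snd).aestronglyMeasurable
        (Eventually.of_forall fun z => hC z.2)
    have jp := ip.integral_prod_left
    have jq := iq.integral_prod_left
    rw [ae_restrict_iff' measurableSet_Ioo]
    refine isOpen_Ioo.ae_eq_zero_of_integral_contDiff_smul_eq_zero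
      (f := fun t => (∫ x in I, p t x * deriv ψ x) + ∫ x in I, q t x * ψ x)
      (IntegrableOn.locallyIntegrableOn (jp.add jq)) fun η η1 η2 η3 => ?_
    have hη : IsTest₁ (Ioo δ T) η := ⟨η1, η2, η3⟩
    obtain ⟨E, hE⟩ := hη.exists_abs_le
    have mη : AEStronglyMeasurable η (volume.restrict (Ioo δ T)) :=
      hη.continuous.aestronglyMeasurable
    have e := H _ (isTest_mul hη hψ)
    rw [volume_restrict_prod_I] at e
    have hdx : ∀ z : ℝ × ℝ, dx (fun z => η z.1 * ψ z.2) z = η z.1 * deriv ψ z.2 := fun z => by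
      simp only [dx, deriv_const_mul_field]
    have cp : ∀ z : ℝ × ℝ, Function.uncurry p z * dx (fun z => η z.1 * ψ z.2) z
        = η z.1 * (p z.1 z.2 * deriv ψ z.2) := fun z => by
      rw [hdx]; simp only [Function.uncurry]; ring
    have cq : ∀ z : ℝ × ℝ, Function.uncurry q z * (η z.1 * ψ z.2)
        = η z.1 * (q z.1 z.2 * ψ z.2) := fun z => by
      simp only [Function.uncurry]; ring
    simp_rw [cp, cq] at e
    have mη' : AEStronglyMeasurable (fun z : ℝ × ℝ => η z.1)
        ((volume.restrict (Ioo δ T)).prod (volume.restrict I)) :=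
      (hη.continuous.comp continuous_fst).aestronglyMeasurable
    rw [integral_prod _ (ip.bdd_mul mη' (Eventually.of_forall fun z => hE z.1)),
      integral_prod _ (iq.bdd_mul mη' (Eventually.of_forall fun z => hE z.1))] at e
    simp only [integral_const_mul] at e
    rw [← setIntegral_eq_integral_of_forall_compl_eq_zero (s := Ioo δ T)
      (fun x hx => by rw [hη.eq_zero hx, zero_smul])]
    simp only [smul_eq_mul, mul_add]
    rw [integral_add (jp.bdd_mul mη (Eventually.of_forall hE))
      (jq.bdd_mul mη (Eventually.of_forall hE)), e, neg_add_cancel]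
  obtain ⟨D, hD, hDt, hdense⟩ := exists_countable_isTest₁_dense
  have hall : ∀ᵐ t ∂(volume.restrict (Ioo δ T)), ∀ χ ∈ D,
      (∫ x in I, p t x * deriv χ x) + ∫ x in I, q t x * χ x = 0 :=
    (ae_ball_iff hD).2 fun χ hχ => hsingle χ (hDt χ hχ)
  filter_upwards [hall, hp.prod_right_ae, hq.prod_right_ae] with t ht hpt hqt
  have hpt' : IntegrableOn (p t) I := hpt
  have hqt' : IntegrableOn (q t) I := hqt
  refine ⟨hpt', hqt', ae_eq_add_primitive hpt' hqt' fun ψ hψ => ?_⟩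
  rw [eq_neg_iff_add_eq_zero, ← abs_nonpos_iff]
  set A := (∫ x in I, |p t x|) + ∫ x in I, |q t x| with hA
  have hA0 : 0 ≤ A := add_nonneg (integral_nonneg fun _ => abs_nonneg _)
    (integral_nonneg fun _ => abs_nonneg _)
  refine le_of_forall_pos_le_add fun ε hε => ?_
  obtain ⟨χ, hχD, hχ⟩ := hdense ψ hψ (ε / (A + 1)) (by positivity)
  have hχt := hDt χ hχD
  have b1 : |∫ x in I, p t x * (deriv ψ x - deriv χ x)|
      ≤ ε / (A + 1) * ∫ x in I, |p t x| := by
    rw [← integral_const_mul, ← Real.norm_eq_abs]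
    refine norm_integral_le_of_norm_le (hpt'.abs.const_mul _) ?_
    filter_upwards [ae_restrict_mem measurableSet_I] with x hx
    rw [Real.norm_eq_abs, abs_mul, abs_sub_comm, mul_comm]
    exact mul_le_mul_of_nonneg_right (hχ x hx).2 (abs_nonneg _)
  have b2 : |∫ x in I, q t x * (ψ x - χ x)| ≤ ε / (A + 1) * ∫ x in I, |q t x| := by
    rw [← integral_const_mul, ← Real.norm_eq_abs]
    refine norm_integral_le_of_norm_le (hqt'.abs.const_mul _) ?_
    filter_upwards [ae_restrict_mem measurableSet_I] with x hx
    rw [Real.norm_eq_abs, abs_mul, abs_sub_comm, mul_comm]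
    exact mul_le_mul_of_nonneg_right (hχ x hx).1 (abs_nonneg _)
  have s1 : ∫ x in I, p t x * (deriv ψ x - deriv χ x)
      = (∫ x in I, p t x * deriv ψ x) - ∫ x in I, p t x * deriv χ x := by
    rw [← integral_sub (hψ.integrableOn_mul_deriv hpt') (hχt.integrableOn_mul_deriv hpt')]
    simp only [mul_sub]
  have s2 : ∫ x in I, q t x * (ψ x - χ x)
      = (∫ x in I, q t x * ψ x) - ∫ x in I, q t x * χ x := by
    rw [← integral_sub (hψ.integrableOn_mul hqt') (hχt.integrableOn_mul hqt')]
    simp only [mul_sub]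
  have e : (∫ x in I, p t x * deriv ψ x) + ∫ x in I, q t x * ψ x
      = (∫ x in I, p t x * (deriv ψ x - deriv χ x)) + ∫ x in I, q t x * (ψ x - χ x) := by
    rw [s1, s2]
    linarith [ht χ hχD]
  rw [e, zero_add]
  calc _ ≤ _ := abs_add_le _ _
    _ ≤ ε / (A + 1) * A := by rw [hA, mul_add]; exact add_le_add b1 b2
    _ ≤ ε / (A + 1) * (A + 1) := by gcongr; linarith
    _ = ε := by field_simp

/-! ### The flux across a local extremum at a fixed time -/

/-- At a fixed time, `v` is a primitive of `w`, and a primitive of `g` is a flux for the slope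
`w`. -/
def IsFluxSlice (L v w g : ℝ → ℝ) : Prop :=
  IntegrableOn w I ∧ IntegrableOn g I ∧ (∃ c, ∀ x ∈ I, v x = c + ∫ y in (0 : ℝ)..x, w y) ∧
    ∃ c, ∀ᵐ x ∂volI, (c + ∫ y in (0 : ℝ)..x, g y) ∈ graph L (w x)

theorem exists_pos_of_primitive_lt {v w : ℝ → ℝ} {P : ℝ → Prop} (hw : IntegrableOn w I) {c : ℝ}
    (hv : ∀ x ∈ I, v x = c + ∫ y in (0 : ℝ)..x, w y) (hP : ∀ᵐ x ∂volI, P x) {x y : ℝ}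
    (hx : x ∈ I) (hy : y ∈ I) (hxy : x < y) (h : v x < v y) :
    ∃ z ∈ Ioo x y, 0 < w z ∧ P z := by
  have hx' := Ioo_subset_Icc_self hx
  have hy' := Ioo_subset_Icc_self hy
  by_contra! hneg
  have hle : ∫ z in x..y, w z ≤ 0 := by
    rw [intervalIntegral.integral_of_le hxy.le, integral_Ioc_eq_integral_Ioo]
    refine integral_nonpos_of_ae ?_
    have hP' : ∀ᵐ z ∂(volume.restrict (Ioo x y)), P z :=
      ae_restrict_of_ae_restrict_of_subset (Ioo_subset_Ioo hx.1.le hy.2.le) hP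
    filter_upwards [ae_restrict_mem measurableSet_Ioo, hP'] with z hz hPz
    by_contra hwz
    exact hneg z hz (not_le.1 hwz) hPz
  have hadd := intervalIntegral.integral_add_adjacent_intervals
    (intervalIntegrable_of_integrableOn_I hw (a := 0) (by simp) hx')
    (intervalIntegrable_of_integrableOn_I hw hx' hy')
  rw [hv x hx, hv y hy] at h
  linarith

/-- On the rising side of an extremum the flux reaches `L(0+)`, on the falling side `L(0-)`, so
that the jump is at most the increment of the flux between a point of either side. -/
theorem IsFluxSlice.exists_jump_le {L v w g : ℝ → ℝ} (hL : Monotone L)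
    (h : IsFluxSlice L v w g) {a b c d : ℝ} (hc : 0 < c) (hca : c < a) (hab : a ≤ b)
    (hbd : b < d) (hd : d < 1)
    (hv : (v c < v a ∧ v d < v b) ∨ (v a < v c ∧ v b < v d)) :
    ∃ y ∈ Ioo c a, ∃ z ∈ Ioo b d, jump L ≤ |∫ x in y..z, g x| := by
  obtain ⟨hw, hg, ⟨k, hk⟩, ⟨e, he⟩⟩ := h
  have hcI : c ∈ I := ⟨hc, by linarith⟩
  have haI : a ∈ I := ⟨by linarith, by linarith⟩
  have hbI : b ∈ I := ⟨by linarith, by linarith⟩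
  have hdI : d ∈ I := ⟨by linarith, hd⟩
  have hkn : ∀ x ∈ I, (-v) x = -k + ∫ y in (0 : ℝ)..x, (-w) y := fun x hx => by
    simp only [Pi.neg_apply, intervalIntegral.integral_neg, hk x hx]
    ring
  have hinc : ∀ y ∈ Ioo c a, ∀ z ∈ Ioo b d,
      (e + ∫ x in (0 : ℝ)..z, g x) - (e + ∫ x in (0 : ℝ)..y, g x) = ∫ x in y..z, g x := by
    intro y hy z hz
    have hy' : y ∈ Icc (0 : ℝ) 1 := ⟨by linarith [hy.1], by linarith [hy.2]⟩
    have hz' : z ∈ Icc (0 : ℝ) 1 := ⟨by linarith [hz.1], by linarith [hz.2]⟩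
    rw [← intervalIntegral.integral_add_adjacent_intervals
      (intervalIntegrable_of_integrableOn_I hg (a := 0) (by simp) hy')
      (intervalIntegrable_of_integrableOn_I hg hy' hz')]
    ring
  rcases hv with ⟨h1, h2⟩ | ⟨h1, h2⟩
  · obtain ⟨y, hy, hwy, hyP⟩ := exists_pos_of_primitive_lt hw hk he hcI haI hca h1
    obtain ⟨z, hz, hwz, hzP⟩ := exists_pos_of_primitive_lt hw.neg hkn he hbI hdI hbd
      (by simpa using h2)
    refine ⟨y, hy, z, hz, ?_⟩
    have i1 := (hL.rightLim_le_leftLim hwy).trans hyP.1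
    have i2 := hzP.2.trans (hL.rightLim_le_leftLim (by simpa using hwz : w z < 0))
    rw [← hinc y hy z hz, abs_sub_comm]
    refine le_trans ?_ (le_abs_self _)
    rw [jump]
    linarith
  · obtain ⟨y, hy, hwy, hyP⟩ := exists_pos_of_primitive_lt hw.neg hkn he hcI haI hca
      (by simpa using h1)
    obtain ⟨z, hz, hwz, hzP⟩ := exists_pos_of_primitive_lt hw hk he hbI hdI hbd h2
    refine ⟨y, hy, z, hz, ?_⟩
    have i1 := hyP.2.trans (hL.rightLim_le_leftLim (by simpa using hwy : w y < 0))
    have i2 := (hL.rightLim_le_leftLim hwz).trans hzP.1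
    rw [← hinc y hy z hz]
    refine le_trans ?_ (le_abs_self _)
    rw [jump]
    linarith

/-! ### Almost every time slice of a solution -/

theorem IsTest.mono {U V : Set (ℝ × ℝ)} {φ : ℝ × ℝ → ℝ} (hφ : IsTest U φ) (hUV : U ⊆ V) :
    IsTest V φ :=
  ⟨hφ.1, hφ.2.1, hφ.2.2.trans hUV⟩

theorem IsTest.eq_zero {U : Set (ℝ × ℝ)} {φ : ℝ × ℝ → ℝ} (hφ : IsTest U φ) {z : ℝ × ℝ}
    (hz : z ∉ U) : φ z = 0 :=
  image_eq_zero_of_notMem_tsupport fun h => hz (hφ.2.2 h)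

theorem IsTest.dx_eq_zero {U : Set (ℝ × ℝ)} {φ : ℝ × ℝ → ℝ} (hφ : IsTest U φ) {z : ℝ × ℝ}
    (hz : z ∉ U) : dx φ z = 0 := by
  have h := notMem_tsupport_iff_eventuallyEq.1 fun h => hz (hφ.2.2 h)
  have hc : Tendsto (fun y => (z.1, y)) (𝓝 z.2) (𝓝 z) :=
    (Continuous.prodMk_right z.1).tendsto z.2
  have h' : (fun y => φ (z.1, y)) =ᶠ[𝓝 z.2] fun _ => 0 := hc.eventually h
  rw [dx, h'.deriv_eq, deriv_const]

theorem IsTest.integrableOn_mul {U V : Set (ℝ × ℝ)} {φ h : ℝ × ℝ → ℝ} (hφ : IsTest U φ)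
    (hh : IntegrableOn h V) : IntegrableOn (fun z => h z * φ z) V := by
  obtain ⟨C, hC⟩ := hφ.2.1.exists_bound_of_continuous hφ.1.continuous
  exact Integrable.mul_bdd hh hφ.1.continuous.aestronglyMeasurable (Eventually.of_forall hC)

theorem ae_restrict_Ioo_zero {T : ℝ} {P : ℝ → Prop}
    (h : ∀ δ > 0, ∀ᵐ t ∂(volume.restrict (Ioo δ T)), P t) :
    ∀ᵐ t ∂(volume.restrict (Ioo 0 T)), P t := by
  have hU : Ioo 0 T ⊆ ⋃ n : ℕ, Ioo (1 / ((n : ℝ) + 1)) T := fun t ht => by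
    obtain ⟨n, hn⟩ := exists_nat_one_div_lt ht.1
    exact mem_iUnion.2 ⟨n, hn, ht.2⟩
  refine ae_restrict_of_ae_restrict_of_subset hU ?_
  rw [ae_restrict_iUnion_iff]
  exact fun n => h _ (by positivity)

instance : IsProbabilityMeasure volI :=
  ⟨by simp [volI, I]⟩

theorem closedCylinder_integrableOn {T : ℝ} {h : ℝ × ℝ → ℝ}
    (hh : ContinuousOn h (Icc 0 T ×ˢ Icc 0 1)) : IntegrableOn h (Q T) :=
  (hh.integrableOn_compact (isCompact_Icc.prod isCompact_Icc)).mono_set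
    (prod_mono Ioo_subset_Icc_self Ioo_subset_Icc_self)

variable {L : ℝ → ℝ} {f : ℝ → ℝ → ℝ} {u₀ : ℝ → ℝ} {T : ℝ} {u ux ut σ : ℝ → ℝ → ℝ}

theorem IsSolution.integrableOn_ut (hu : IsSolution L f u₀ T u ux ut σ) {δ : ℝ} (hδ : 0 < δ) :
    IntegrableOn (Function.uncurry ut) (Ioo δ T ×ˢ I) := by
  have hm := hu.ut_measurable.mono_set (s := Ioo δ T ×ˢ I)
    (prod_mono (Ioo_subset_Ioo_left hδ.le) subset_rfl)
  rw [IntegrableOn]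
  rw [volume_restrict_prod_I] at hm ⊢
  refine ⟨hm, ?_⟩
  obtain ⟨C, hC⟩ := hu.ut_bound δ hδ
  rw [HasFiniteIntegral, lintegral_prod _ hm.enorm]
  have hle : ∀ᵐ t ∂(volume.restrict (Ioo δ T)),
      ∫⁻ x in I, ‖Function.uncurry ut (t, x)‖ₑ ≤ (C : ℝ≥0∞) := by
    filter_upwards [hC, hm.prodMk_left] with t ht hmt
    have h12 : eLpNorm (ut t) 1 volI ≤ eLpNorm (ut t) 2 volI :=
      eLpNorm_le_eLpNorm_of_exponent_le (by norm_num) hmt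
    rw [eLpNorm_one_eq_lintegral_enorm] at h12
    exact h12.trans ht
  refine (lintegral_mono_ae hle).trans_lt ?_
  rw [lintegral_const]
  exact ENNReal.mul_lt_top ENNReal.coe_lt_top (measure_lt_top _ _)

theorem IsSolution.ae_isFluxSlice (hu : IsSolution L f u₀ T u ux ut σ)
    (hf : ContinuousOn (Function.uncurry f) (Icc 0 T ×ˢ Icc 0 1)) :
    ∀ᵐ t ∂(volume.restrict (Ioo 0 T)),
      IntegrableOn (ut t) I ∧ IsFluxSlice L (u t) (ux t) (fun x => ut t x - f t x) := by
  refine ae_restrict_Ioo_zero fun δ hδ => ?_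
  have hsub : Ioo δ T ×ˢ I ⊆ Q T := prod_mono (Ioo_subset_Ioo_left hδ.le) subset_rfl
  have hQ : MeasurableSet (Q T) := measurableSet_Ioo.prod measurableSet_I
  have restr : ∀ F : ℝ × ℝ → ℝ, (∀ z ∉ Ioo δ T ×ˢ I, F z = 0) →
      ∫ z in Q T, F z = ∫ z in Ioo δ T ×ˢ I, F z := fun F hF =>
    setIntegral_eq_of_subset_of_forall_sdiff_eq_zero hQ hsub fun z hz => hF z hz.2
  have iu := (closedCylinder_integrableOn hu.continuousOn).mono_set hsub
  have ift := (closedCylinder_integrableOn hf).mono_set hsub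
  have iut := hu.integrableOn_ut hδ
  have S1 := ae_slice_eq_add_primitive iu (hu.ux_integrable.mono_set hsub) fun φ hφ => by
    have e := hu.ux_weak φ (hφ.mono hsub)
    rwa [restr _ fun z hz => by rw [hφ.dx_eq_zero hz, mul_zero],
      restr _ fun z hz => by rw [hφ.eq_zero hz, mul_zero]] at e
  have S2 := ae_slice_eq_add_primitive (q := fun t x => ut t x - f t x)
    (hu.flux_integrable.mono_set hsub) (iut.sub ift) fun φ hφ => by
      have hsub' : Ioo δ T ×ˢ I ⊆ Iio T ×ˢ I := prod_mono (fun t ht => ht.2) subset_rfl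
      have e := hu.weak_form φ (hφ.mono hsub')
      have e' := hu.ut_weak φ (hφ.mono hsub)
      have e0 : ∀ x, φ (0, x) = 0 := fun x => hφ.eq_zero fun h => by
        linarith [h.1.1]
      simp only [e0, mul_zero, integral_zero, sub_zero] at e
      rw [e', neg_neg, restr _ fun z hz => by rw [hφ.eq_zero hz, mul_zero],
        restr _ fun z hz => by rw [hφ.dx_eq_zero hz, mul_zero],
        restr (fun z => Function.uncurry f z * φ z)
          fun z hz => by rw [hφ.eq_zero hz, mul_zero]] at e
      have es : ∫ z in Ioo δ T ×ˢ I, Function.uncurry (fun t x => ut t x - f t x) z * φ z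
          = (∫ z in Ioo δ T ×ˢ I, Function.uncurry ut z * φ z)
            - ∫ z in Ioo δ T ×ˢ I, Function.uncurry f z * φ z := by
        rw [← integral_sub (hφ.integrableOn_mul iut) (hφ.integrableOn_mul ift)]
        refine integral_congr_ae (Eventually.of_forall fun z => ?_)
        simp only [Function.uncurry]
        ring
      rw [es]
      linarith
  have hgr : ∀ᵐ t ∂(volume.restrict (Ioo δ T)), ∀ᵐ x ∂volI, σ t x ∈ graph L (ux t x) := by
    have h := ae_restrict_of_ae_restrict_of_subset hsub hu.flux_mem
    rw [volume_restrict_prod_I] at h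
    exact Measure.ae_ae_of_ae_prod h
  have hut : ∀ᵐ t ∂(volume.restrict (Ioo δ T)), IntegrableOn (ut t) I := by
    rw [IntegrableOn, volume_restrict_prod_I] at iut
    exact iut.prod_right_ae
  filter_upwards [S1, S2, hgr, hut, ae_restrict_mem measurableSet_Ioo]
    with t h1 h2 h3 h4 ht
  obtain ⟨-, hw, c, hc⟩ := h1
  obtain ⟨-, hg, e, he⟩ := h2
  refine ⟨h4, hw, hg, ⟨c, ?_⟩, e, ?_⟩
  · -- two continuous functions that agree almost everywhere on an open set agree on it
    have hvc : ContinuousOn (u t) I := by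
      refine hu.continuousOn.comp (f := fun x => (t, x))
        (Continuous.prodMk_right t).continuousOn fun x hx => ?_
      exact ⟨⟨hδ.le.trans ht.1.le, ht.2.le⟩, Ioo_subset_Icc_self hx⟩
    exact Measure.eqOn_open_of_ae_eq hc isOpen_Ioo hvc
      (continuousOn_const.add ((continuousOn_primitive_I hw).mono Ioo_subset_Icc_self))
  · filter_upwards [h3, he] with x hx hx'
    rwa [← hx']

/-! ### Extremal plateaus -/

theorem IsExtremalPlateau.le {v : ℝ → ℝ} {a b : ℝ} (h : IsExtremalPlateau v a b) : a ≤ b :=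
  h.2.2.1.2.2.1.2

theorem IsExtremalPlateau.eq_right {v : ℝ → ℝ} {a b : ℝ} (h : IsExtremalPlateau v a b) :
    v b = v a :=
  h.2.2.1.2.2.2.1 b ⟨h.le, le_rfl⟩

theorem IsExtremalPlateau.exists_ne_left {v : ℝ → ℝ} {a b : ℝ} (h : IsExtremalPlateau v a b)
    {P : ℝ → Prop} (hP : ∀ᶠ x in 𝓝 a, P x) : ∃ c < a, v c ≠ v a ∧ P c := by
  obtain ⟨ha, hb, ⟨-, -, -, hconst, hmax⟩, -⟩ := id h
  obtain ⟨r, hr, hrP⟩ := Metric.eventually_nhds_iff.1 (hP.and (lt_mem_nhds ha))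
  have h0 : 0 < a - r / 2 := (hrP (y := a - r / 2) (by
    rw [Real.dist_eq, show a - r / 2 - a = -(r / 2) by ring, abs_neg, abs_of_pos (by linarith)]
    linarith)).2
  by_contra! hcon
  have := (hmax (a - r / 2) b h0.le hb.le ⟨by linarith, h.le⟩ fun x hx => by
    rcases lt_or_ge x a with hxa | hxa
    · by_contra hne
      refine hcon x hxa hne (hrP ?_).1
      rw [Real.dist_eq, abs_of_neg (by linarith)]
      linarith [hx.1]
    · exact hconst x ⟨hxa, hx.2⟩).1
  linarith

theorem IsExtremalPlateau.exists_ne_right {v : ℝ → ℝ} {a b : ℝ} (h : IsExtremalPlateau v a b)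
    {P : ℝ → Prop} (hP : ∀ᶠ x in 𝓝 b, P x) : ∃ d > b, v d ≠ v a ∧ P d := by
  obtain ⟨ha, hb, ⟨-, -, -, hconst, hmax⟩, -⟩ := id h
  obtain ⟨r, hr, hrP⟩ := Metric.eventually_nhds_iff.1 (hP.and (gt_mem_nhds hb))
  have h1 : b + r / 2 < 1 := (hrP (y := b + r / 2) (by
    rw [Real.dist_eq, show b + r / 2 - b = r / 2 by ring, abs_of_pos (by linarith)]
    linarith)).2
  by_contra! hcon
  have := (hmax a (b + r / 2) ha.le h1.le ⟨le_rfl, by linarith [h.le]⟩ fun x hx => by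
    rcases lt_or_ge b x with hxb | hxb
    · by_contra hne
      refine hcon x hxb hne (hrP ?_).1
      rw [Real.dist_eq, abs_of_pos (by linarith)]
      linarith [hx.2]
    · exact hconst x ⟨hx.1, hxb⟩).2
  linarith

/-- Arbitrarily close to an extremal plateau, on both sides, the function lies strictly below
(or strictly above) its value on the plateau. -/
theorem IsExtremalPlateau.exists_strict {v : ℝ → ℝ} {a b : ℝ} (h : IsExtremalPlateau v a b)
    {ε : ℝ} (hε : 0 < ε) : ∃ c d, 0 < c ∧ a - ε < c ∧ c < a ∧ b < d ∧ d < b + ε ∧ d < 1 ∧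
      ((v c < v a ∧ v d < v b) ∨ (v a < v c ∧ v b < v d)) := by
  have na : 𝓝 a ≤ 𝓝ˢ (Icc a b) := nhds_le_nhdsSet ⟨le_rfl, h.le⟩
  have nb : 𝓝 b ≤ 𝓝ˢ (Icc a b) := nhds_le_nhdsSet ⟨h.le, le_rfl⟩
  have ea : ∀ᶠ x in 𝓝 a, 0 < x ∧ a - ε < x := (lt_mem_nhds h.1).and (lt_mem_nhds (by linarith))
  have eb : ∀ᶠ x in 𝓝 b, x < 1 ∧ x < b + ε :=
    (gt_mem_nhds h.2.1).and (gt_mem_nhds (by linarith))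
  rw [h.eq_right]
  rcases h.2.2.2 with hm | hm
  · obtain ⟨c, hca, hc, ⟨c0, cε⟩, hcm⟩ := h.exists_ne_left (ea.and (na hm))
    obtain ⟨d, hbd, hd, ⟨d1, dε⟩, hdm⟩ := h.exists_ne_right (eb.and (nb hm))
    exact ⟨c, d, c0, cε, hca, hbd, dε, d1, .inl ⟨lt_of_le_of_ne hcm hc, lt_of_le_of_ne hdm hd⟩⟩
  · obtain ⟨c, hca, hc, ⟨c0, cε⟩, hcm⟩ := h.exists_ne_left (ea.and (na hm))
    obtain ⟨d, hbd, hd, ⟨d1, dε⟩, hdm⟩ := h.exists_ne_right (eb.and (nb hm))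
    exact ⟨c, d, c0, cε, hca, hbd, dε, d1,
      .inr ⟨lt_of_le_of_ne hcm hc.symm, lt_of_le_of_ne hdm hd.symm⟩⟩

/-! ### Bounds of the flux increment -/

/-- The Cauchy-Schwarz inequality on a subinterval of `I`. -/
theorem abs_integral_le_mul_sqrt {h : ℝ → ℝ} (hh : IntegrableOn h I) {M : ℝ≥0}
    (hM : normI h 2 ≤ M) {y z : ℝ} (hy : y ∈ I) (hz : z ∈ I) (hyz : y < z) :
    |∫ x in y..z, h x| ≤ M * √(z - y) := by
  have hsub : Ioc y z ⊆ I := fun x hx => ⟨hy.1.trans hx.1, hx.2.trans_lt hz.2⟩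
  have hi : IntegrableOn h (Ioc y z) := hh.mono_set hsub
  have h1 := eLpNorm_le_eLpNorm_mul_rpow_measure_univ (p := 1) (q := 2) (by norm_num)
    hi.aestronglyMeasurable
  have h2 : eLpNorm h 2 (volume.restrict (Ioc y z)) ≤ M :=
    (eLpNorm_mono_measure h (Measure.restrict_mono_set _ hsub)).trans hM
  rw [Measure.restrict_apply_univ, Real.volume_Ioc, eLpNorm_one_eq_lintegral_enorm] at h1
  have hexp : (1 : ℝ) / (1 : ℝ≥0∞).toReal - 1 / (2 : ℝ≥0∞).toReal = 1 / 2 := by norm_num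
  rw [hexp, ENNReal.ofReal_rpow_of_nonneg (by linarith) (by norm_num), ← Real.sqrt_eq_rpow] at h1
  have h3 : ∫⁻ x in Ioc y z, ‖h x‖ₑ ≤ ENNReal.ofReal (M * √(z - y)) := by
    refine h1.trans ?_
    rw [ENNReal.ofReal_mul M.coe_nonneg, ENNReal.ofReal_coe_nnreal]
    gcongr
  rw [intervalIntegral.integral_of_le hyz.le, ← Real.norm_eq_abs]
  refine (norm_integral_le_integral_norm _).trans ?_
  rw [integral_norm_eq_lintegral_enorm hi.aestronglyMeasurable]
  exact ENNReal.toReal_le_of_le_ofReal (by positivity) h3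

theorem ae_abs_le_of_normI_top_le {h : ℝ → ℝ} {M : ℝ≥0} (hM : normI h ⊤ ≤ M) :
    ∀ᵐ x ∂volI, |h x| ≤ M := by
  rw [normI, eLpNorm_exponent_top] at hM
  filter_upwards [ae_le_eLpNormEssSup (f := h) (μ := volI)] with x hx
  have := hx.trans hM
  rw [enorm_le_coe] at this
  exact_mod_cast this

theorem abs_integral_le_mul_of_ae_le {h : ℝ → ℝ} {M : ℝ} (hM : ∀ᵐ x ∂volI, |h x| ≤ M) {y z : ℝ}
    (hy : y ∈ I) (hz : z ∈ I) (hyz : y < z) : |∫ x in y..z, h x| ≤ M * (z - y) := by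
  rw [volI, ae_restrict_iff' measurableSet_I] at hM
  have := intervalIntegral.norm_integral_le_of_norm_le_const_ae (f := h) (a := y) (b := z)
    (C := M) (by
      filter_upwards [hM] with x hx hx'
      rw [uIoc_of_le hyz.le] at hx'
      exact hx ⟨hy.1.trans hx'.1, hx'.2.trans_lt hz.2⟩)
  rwa [Real.norm_eq_abs, abs_of_pos (by linarith : 0 < z - y)] at this

theorem continuousOn_slice {T : ℝ} {f : ℝ → ℝ → ℝ}
    (hf : ContinuousOn (Function.uncurry f) (Icc 0 T ×ˢ Icc 0 1)) {t : ℝ} (ht : t ∈ Icc 0 T) :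
    ContinuousOn (f t) (Icc 0 1) :=
  hf.comp (f := fun x => (t, x)) (Continuous.prodMk_right t).continuousOn fun _ hx => ⟨ht, hx⟩

theorem normI_top_lt_top {g : ℝ → ℝ} (hg : ContinuousOn g (Icc 0 1)) : normI g ⊤ < ⊤ := by
  obtain ⟨C, hC⟩ := isCompact_Icc.exists_bound_of_continuousOn hg
  rw [normI, eLpNorm_exponent_top]
  refine eLpNormEssSup_lt_top_of_ae_bound (C := C) ?_
  rw [volI]
  filter_upwards [ae_restrict_mem measurableSet_I] with x hx
  exact hC x (Ioo_subset_Icc_self hx)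

theorem eventually_forall_abs_sub_le {T : ℝ} {f : ℝ → ℝ → ℝ}
    (hf : ContinuousOn (Function.uncurry f) (Icc 0 T ×ˢ Icc 0 1)) {t : ℝ} (ht : t ∈ Icc 0 T)
    {ε : ℝ} (hε : 0 < ε) :
    ∀ᶠ s in 𝓝[Icc 0 T] t, ∀ x ∈ Icc (0 : ℝ) 1, |f s x - f t x| ≤ ε := by
  have huc := (isCompact_Icc.prod isCompact_Icc).uniformContinuousOn_of_continuous hf
  obtain ⟨r, hr, h⟩ := Metric.uniformContinuousOn_iff.1 huc ε hε
  filter_upwards [self_mem_nhdsWithin, mem_nhdsWithin_of_mem_nhds (Metric.ball_mem_nhds t hr)]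
    with s hs hsr x hx
  refine (h (s, x) ⟨hs, hx⟩ (t, x) ⟨ht, hx⟩ ?_).le
  rw [Prod.dist_eq, dist_self]
  exact max_lt hsr hr

/-- What holds at almost every time of an interval holds at times of it arbitrarily close to any
point of its closure. -/
theorem frequently_nhdsWithin_of_ae {T t₁ t₂ t : ℝ} {P : ℝ → Prop} (h₁ : 0 ≤ t₁) (h₂ : t₂ ≤ T)
    (h₁₂ : t₁ < t₂) (ht : t ∈ Icc t₁ t₂) (hP : ∀ᵐ s ∂(volume.restrict (Ioo t₁ t₂)), P s) :
    ∃ᶠ s in 𝓝[Icc 0 T] t, P s := by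
  rw [frequently_iff]
  intro U hU
  obtain ⟨V, hV, htV, hVU⟩ := mem_nhdsWithin.1 hU
  have hne : (V ∩ Ioo t₁ t₂).Nonempty := by
    rw [← closure_Ioo h₁₂.ne] at ht
    exact mem_closure_iff.1 ht V hV htV
  have hpos := (hV.inter isOpen_Ioo).measure_pos (volume : Measure ℝ) hne
  have : (ae ((volume : Measure ℝ).restrict (V ∩ Ioo t₁ t₂))).NeBot := by
    rw [ae_neBot, Ne, Measure.restrict_eq_zero]
    exact hpos.ne'
  obtain ⟨s, hs, hPs⟩ := ((ae_restrict_mem (hV.inter isOpen_Ioo).measurableSet).and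
    (ae_restrict_of_ae_restrict_of_subset inter_subset_right hP)).exists
  exact ⟨s, hVU ⟨hs.1, h₁.trans hs.2.1.le, hs.2.2.le.trans h₂⟩, hPs⟩

/-! ### Lower bounds of the length of an extremal plateau -/

/-- The strict inequalities at two fixed points just outside the plateau persist for times near
`t`. At those of them where the slice has a flux, the jump is bounded by the flux increment across
the enlarged plateau; then the enlargement tends to zero. The modulus `ρ` is the square root for
`L²` bounds of `ut`, the identity for `L^∞` bounds. -/
theorem jump_le_of_frequently (hL : Monotone L)
    (hf : ContinuousOn (Function.uncurry f) (Icc 0 T ×ˢ Icc 0 1))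
    (hu : ContinuousOn (Function.uncurry u) (Icc 0 T ×ˢ Icc 0 1))
    {ρ : ℝ → ℝ} (hρ : Continuous ρ) (hmono : Monotone ρ) (hid : ∀ l ∈ Icc (0 : ℝ) 1, l ≤ ρ l)
    {t : ℝ} (ht : t ∈ Icc 0 T) {M : ℝ≥0}
    (hfreq : ∃ᶠ s in 𝓝[Icc 0 T] t, IntegrableOn (ut s) I ∧
      IsFluxSlice L (u s) (ux s) (fun x => ut s x - f s x) ∧
      ∀ y ∈ I, ∀ z ∈ I, y < z → |∫ x in y..z, ut s x| ≤ M * ρ (z - y))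
    {a b : ℝ} (hab : IsExtremalPlateau (u t) a b) :
    jump L ≤ ((normI (f t) ⊤).toReal + M) * ρ (b - a) := by
  set F := (normI (f t) ⊤).toReal with hF
  have hF0 : 0 ≤ F := ENNReal.toReal_nonneg
  have hFae : ∀ᵐ x ∂volI, |f t x| ≤ F :=
    ae_abs_le_of_normI_top_le (M := (normI (f t) ⊤).toNNReal)
      (ENNReal.coe_toNNReal (normI_top_lt_top (continuousOn_slice hf ht)).ne).ge
  have key : ∀ ε > 0, jump L ≤ (F + ε + M) * ρ (b - a + 2 * ε) := by
    intro ε hε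
    obtain ⟨c, d, c0, cε, hca, hbd, dε, d1, hv⟩ := hab.exists_strict hε
    have hle := hab.le
    have hcont : ∀ x ∈ Icc (0 : ℝ) 1, Tendsto (fun s => u s x) (𝓝[Icc 0 T] t) (𝓝 (u t x)) :=
      fun x hx => (hu.comp (f := fun s => (s, x)) (Continuous.prodMk_left x).continuousOn
        fun _ hs => ⟨hs, hx⟩) t ht
    have tc := hcont c ⟨c0.le, by linarith⟩
    have ta := hcont a ⟨by linarith, by linarith⟩
    have tb := hcont b ⟨by linarith, by linarith⟩
    have td := hcont d ⟨by linarith, d1.le⟩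
    have hev : ∀ᶠ s in 𝓝[Icc 0 T] t,
        (u s c < u s a ∧ u s d < u s b) ∨ (u s a < u s c ∧ u s b < u s d) := by
      rcases hv with ⟨h1, h2⟩ | ⟨h1, h2⟩
      · exact ((tc.eventually_lt ta h1).and (td.eventually_lt tb h2)).mono fun _ => .inl
      · exact ((ta.eventually_lt tc h1).and (tb.eventually_lt td h2)).mono fun _ => .inr
    obtain ⟨s, ⟨hut, hsl, hbound⟩, hsv, hsf, hs⟩ := (hfreq.and_eventually
      (hev.and ((eventually_forall_abs_sub_le hf ht hε).and self_mem_nhdsWithin))).exists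
    obtain ⟨y, hy, z, hz, hJ⟩ := hsl.exists_jump_le hL c0 hca hle hbd d1 hsv
    have hyI : y ∈ I := ⟨c0.trans hy.1, by linarith [hy.2]⟩
    have hzI : z ∈ I := ⟨by linarith [hz.1], hz.2.trans d1⟩
    have hyz : y < z := by linarith [hy.2, hz.1]
    have hfs : ∀ᵐ x ∂volI, |f s x| ≤ F + ε := by
      have hmem : ∀ᵐ x ∂volI, x ∈ I := ae_restrict_mem measurableSet_I
      filter_upwards [hFae, hmem] with x hx hxI
      have h1 := hsf x (Ioo_subset_Icc_self hxI)
      have h2 := abs_add_le (f s x - f t x) (f t x)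
      rw [sub_add_cancel] at h2
      linarith
    have hfi : IntegrableOn (f s) I :=
      ((continuousOn_slice hf hs).integrableOn_compact isCompact_Icc).mono_set
        Ioo_subset_Icc_self
    have hyc := Ioo_subset_Icc_self hyI
    have hzc := Ioo_subset_Icc_self hzI
    rw [intervalIntegral.integral_sub (intervalIntegrable_of_integrableOn_I hut hyc hzc)
      (intervalIntegrable_of_integrableOn_I hfi hyc hzc)] at hJ
    have h1 := hbound y hyI z hzI hyz
    have h2 := abs_integral_le_mul_of_ae_le hfs hyI hzI hyz
    have h3 : z - y ≤ ρ (z - y) := hid _ ⟨by linarith, by linarith [hyI.1, hzI.2]⟩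
    have h4 : ρ (z - y) ≤ ρ (b - a + 2 * ε) := hmono (by linarith [hy.1, hz.2])
    have h5 : (F + ε) * (z - y) ≤ (F + ε) * ρ (z - y) :=
      mul_le_mul_of_nonneg_left h3 (by linarith)
    have h6 : (F + ε + M) * ρ (z - y) ≤ (F + ε + M) * ρ (b - a + 2 * ε) :=
      mul_le_mul_of_nonneg_left h4 (by positivity)
    have h7 := abs_sub (∫ x in y..z, ut s x) (∫ x in y..z, f s x)
    linarith
  have hlim : Tendsto (fun ε => (F + ε + M) * ρ (b - a + 2 * ε)) (𝓝[>] 0)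
      (𝓝 ((F + M) * ρ (b - a))) := by
    have hc : Continuous fun ε => (F + ε + M) * ρ (b - a + 2 * ε) := by fun_prop
    have := hc.tendsto 0
    simp only [add_zero, mul_zero] at this
    exact this.mono_left nhdsWithin_le_nhds
  exact ge_of_tendsto hlim (eventually_mem_nhdsWithin.mono key)

theorem sqrt_length_bound {J K l : ℝ} (hJ : 0 < J) (hK : 0 ≤ K) (hl : 0 ≤ l)
    (h : J ≤ K * √l) : 0 < K ∧ (J / K) ^ 2 ≤ l := by
  have hK' : 0 < K := by
    rcases hK.eq_or_lt with rfl | h'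
    · simp only [zero_mul] at h
      linarith
    · exact h'
  refine ⟨hK', ?_⟩
  rw [← Real.le_sqrt (by positivity) hl, div_le_iff₀ hK', mul_comm]
  exact h

theorem length_bound {J K l : ℝ} (hJ : 0 < J) (hK : 0 ≤ K) (h : J ≤ K * l) :
    0 < K ∧ J / K ≤ l := by
  have hK' : 0 < K := by
    rcases hK.eq_or_lt with rfl | h'
    · simp only [zero_mul] at h
      linarith
    · exact h'
  refine ⟨hK', ?_⟩
  rwa [div_le_iff₀ hK', mul_comm]

theorem le_sqrt_of_mem_Icc {l : ℝ} (hl : l ∈ Icc (0 : ℝ) 1) : l ≤ √l :=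
  Real.le_sqrt_of_sq_le (by nlinarith [hl.1, hl.2])

theorem length_bound_of_frequently_two (hL : Monotone L) (hJ : 0 < jump L)
    (hf : ContinuousOn (Function.uncurry f) (Icc 0 T ×ˢ Icc 0 1))
    (hu : ContinuousOn (Function.uncurry u) (Icc 0 T ×ˢ Icc 0 1))
    {t : ℝ} (ht : t ∈ Icc 0 T) {M : ℝ≥0}
    (hfreq : ∃ᶠ s in 𝓝[Icc 0 T] t, (IntegrableOn (ut s) I ∧
      IsFluxSlice L (u s) (ux s) (fun x => ut s x - f s x)) ∧ normI (ut s) 2 ≤ M)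
    {a b : ℝ} (hab : IsExtremalPlateau (u t) a b) :
    0 < (normI (f t) ⊤).toReal + M ∧ (jump L / ((normI (f t) ⊤).toReal + M)) ^ 2 ≤ b - a :=
  sqrt_length_bound hJ (by positivity) (sub_nonneg.2 hab.le)
    (jump_le_of_frequently (ux := ux) (ut := ut) hL hf hu Real.continuous_sqrt
      (fun _ _ => Real.sqrt_le_sqrt) (fun _ => le_sqrt_of_mem_Icc) ht
      (hfreq.mono fun _ h => ⟨h.1.1, h.1.2, fun _ hy _ hz hyz =>
        abs_integral_le_mul_sqrt h.1.1 h.2 hy hz hyz⟩) hab)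

theorem length_bound_of_frequently_top (hL : Monotone L) (hJ : 0 < jump L)
    (hf : ContinuousOn (Function.uncurry f) (Icc 0 T ×ˢ Icc 0 1))
    (hu : ContinuousOn (Function.uncurry u) (Icc 0 T ×ˢ Icc 0 1))
    {t : ℝ} (ht : t ∈ Icc 0 T) {M : ℝ≥0}
    (hfreq : ∃ᶠ s in 𝓝[Icc 0 T] t, (IntegrableOn (ut s) I ∧
      IsFluxSlice L (u s) (ux s) (fun x => ut s x - f s x)) ∧ normI (ut s) ⊤ ≤ M)
    {a b : ℝ} (hab : IsExtremalPlateau (u t) a b) :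
    0 < (normI (f t) ⊤).toReal + M ∧ jump L / ((normI (f t) ⊤).toReal + M) ≤ b - a :=
  length_bound hJ (by positivity)
    (jump_le_of_frequently (ux := ux) (ut := ut) hL hf hu continuous_id monotone_id
      (fun _ _ => le_rfl) ht
      (hfreq.mono fun _ h => ⟨h.1.1, h.1.2, fun _ hy _ hz hyz =>
        abs_integral_le_mul_of_ae_le (ae_abs_le_of_normI_top_le h.2) hy hz hyz⟩) hab)

/-- The plateau through `x₀` is the connected component of `x₀` in the level set of `v`. -/
theorem exists_isPlateau {v : ℝ → ℝ} (hv : ContinuousOn v (Icc 0 1)) {x₀ : ℝ}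
    (hx₀ : x₀ ∈ Ioo (0 : ℝ) 1) : ∃ a b, IsPlateau v x₀ a b := by
  have hx : x₀ ∈ Icc (0 : ℝ) 1 := Ioo_subset_Icc_self hx₀
  set S : Set ℝ := Icc 0 1 ∩ v ⁻¹' {v x₀} with hS
  have hSc : IsClosed S := hv.preimage_isClosed_of_isClosed isClosed_Icc isClosed_singleton
  have hxS : x₀ ∈ S := ⟨hx, rfl⟩
  have hKS := connectedComponentIn_subset S x₀
  have hKc : IsClosed (connectedComponentIn S x₀) := isClosed_of_closure_subset <|
    isPreconnected_connectedComponentIn.closure.subset_connectedComponentIn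
      (subset_closure (mem_connectedComponentIn hxS)) (closure_minimal hKS hSc)
  have hK : IsCompact (connectedComponentIn S x₀) :=
    isCompact_Icc.of_isClosed_subset hKc (hKS.trans inter_subset_left)
  have hcon : IsConnected (connectedComponentIn S x₀) := isConnected_connectedComponentIn_iff.2 hxS
  have hIcc := eq_Icc_of_connected_compact hcon hK
  have hmem : x₀ ∈ connectedComponentIn S x₀ := mem_connectedComponentIn hxS
  set a := sInf (connectedComponentIn S x₀)
  set b := sSup (connectedComponentIn S x₀)
  rw [hIcc] at hmem hKS
  have hab : a ≤ b := hmem.1.trans hmem.2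
  refine ⟨a, b, (hKS ⟨le_rfl, hab⟩).1.1, (hKS ⟨hab, le_rfl⟩).1.2, hmem,
    fun x hx => (hKS hx).2, fun a' b' ha' hb' hx' hc => ?_⟩
  have hsub : Icc a' b' ⊆ connectedComponentIn S x₀ :=
    isPreconnected_Icc.subset_connectedComponentIn hx'
      fun x hx => ⟨⟨ha'.trans hx.1, hx.2.trans hb'⟩, hc x hx⟩
  rw [hIcc] at hsub
  have hab' : a' ≤ b' := hx'.1.trans hx'.2
  exact ⟨(hsub ⟨le_rfl, hab'⟩).1, (hsub ⟨hab', le_rfl⟩).2⟩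

theorem IsPlateau.isExtremalPlateau_singleton {v : ℝ → ℝ} {x₀ : ℝ} (h : IsPlateau v x₀ x₀ x₀)
    (hx₀ : x₀ ∈ Ioo (0 : ℝ) 1) (he : IsLocalExtr v x₀) : IsExtremalPlateau v x₀ x₀ := by
  refine ⟨hx₀.1, hx₀.2, h, ?_⟩
  rw [Icc_self, nhdsSet_singleton]
  exact he.symm

end Facet

theorem lemmal (L : ℝ → ℝ) (hL : Monotone L) (hJ : 0 < Facet.jump L)
    (T : ℝ) (hT : 0 < T) (f : ℝ → ℝ → ℝ)
    (hf : ContDiffOn ℝ ∞ (Function.uncurry f) (Icc 0 T ×ˢ Icc 0 1))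
    (u₀ : ℝ → ℝ) (u ux ut σ : ℝ → ℝ → ℝ) (hu : Facet.IsSolution L f u₀ T u ux ut σ) :
    -- at every positive time each interior local extremum is attained on a nontrivial interval
    (∀ t ∈ Ioc 0 T, ∀ x₀ ∈ Ioo (0 : ℝ) 1, IsLocalExtr (u t) x₀ →
      ∃ a b, a < b ∧ Facet.IsPlateau (u t) x₀ a b) ∧
    -- lower bounds of the length at a.e. time, by the norms of `u_t` at that time
    (∀ᵐ t ∂(volume.restrict (Ioo 0 T)), ∀ a b, Facet.IsExtremalPlateau (u t) a b →
      (0 < (Facet.normI (f t) ⊤).toReal + (Facet.normI (ut t) 2).toReal ∧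
        (Facet.jump L / ((Facet.normI (f t) ⊤).toReal + (Facet.normI (ut t) 2).toReal)) ^ 2
          ≤ b - a) ∧
      (Facet.normI (ut t) ⊤ < ⊤ →
        0 < (Facet.normI (f t) ⊤).toReal + (Facet.normI (ut t) ⊤).toReal ∧
        Facet.jump L / ((Facet.normI (f t) ⊤).toReal + (Facet.normI (ut t) ⊤).toReal)
          ≤ b - a)) ∧
    -- lower bounds of the length at every positive time `t`, by any essential bound `M` of the
    -- norms of `u_t` on a (possibly one-sided) time interval at `t`
    (∀ t ∈ Ioc 0 T, ∀ t₁ t₂, 0 ≤ t₁ → t₂ ≤ T → t₁ < t₂ → t ∈ Icc t₁ t₂ → ∀ M : ℝ≥0,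
      ∀ a b, Facet.IsExtremalPlateau (u t) a b →
      ((∀ᵐ s ∂(volume.restrict (Ioo t₁ t₂)), Facet.normI (ut s) 2 ≤ M) →
        0 < (Facet.normI (f t) ⊤).toReal + M ∧
        (Facet.jump L / ((Facet.normI (f t) ⊤).toReal + M)) ^ 2 ≤ b - a) ∧
      ((∀ᵐ s ∂(volume.restrict (Ioo t₁ t₂)), Facet.normI (ut s) ⊤ ≤ M) →
        0 < (Facet.normI (f t) ⊤).toReal + M ∧
        Facet.jump L / ((Facet.normI (f t) ⊤).toReal + M) ≤ b - a)) := by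
  have hfc := hf.continuousOn
  have huc := hu.continuousOn
  have hgood := hu.ae_isFluxSlice hfc
  have hnear : ∀ t ∈ Ioc 0 T, ∀ t₁ t₂, 0 ≤ t₁ → t₂ ≤ T → t₁ < t₂ → t ∈ Icc t₁ t₂ →
      ∀ P : ℝ → Prop, (∀ᵐ s ∂(volume.restrict (Ioo t₁ t₂)), P s) →
      ∃ᶠ s in 𝓝[Icc 0 T] t, (IntegrableOn (ut s) Facet.I ∧
        Facet.IsFluxSlice L (u s) (ux s) (fun x => ut s x - f s x)) ∧ P s := by
    intro t ht t₁ t₂ h₁ h₂ h₁₂ htt P hP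
    have hg := ae_restrict_of_ae_restrict_of_subset (Ioo_subset_Ioo h₁ h₂) hgood
    exact Facet.frequently_nhdsWithin_of_ae h₁ h₂ h₁₂ htt (hg.and hP)
  have hIcc : ∀ t ∈ Ioc 0 T, t ∈ Icc 0 T := fun t ht => Ioc_subset_Icc_self ht
  refine ⟨?_, ?_, ?_⟩
  · -- a degenerate plateau at a local extremum is extremal, so it would have positive length
    intro t ht x₀ hx₀ hext
    obtain ⟨a, b, hab⟩ :=
      Facet.exists_isPlateau (Facet.continuousOn_slice huc (hIcc t ht)) hx₀
    refine ⟨a, b, ?_, hab⟩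
    by_contra hlt
    have hx := hab.2.2.1
    obtain rfl : a = x₀ := le_antisymm hx.1 (hx.2.trans (not_lt.1 hlt))
    obtain rfl : b = a := le_antisymm (not_lt.1 hlt) hx.2
    obtain ⟨C, hC⟩ := hu.ut_bound (t / 2) (half_pos ht.1)
    have hlen := (Facet.length_bound_of_frequently_two hL hJ hfc huc (hIcc t ht)
      (hnear t ht (t / 2) T (by linarith [ht.1]) le_rfl (by linarith [ht.1, ht.2])
        ⟨by linarith [ht.1], ht.2⟩ _ hC) (hab.isExtremalPlateau_singleton hx₀ hext))
    have hpos : 0 < (Facet.jump L / ((Facet.normI (f t) ⊤).toReal + C)) ^ 2 :=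
      pow_pos (div_pos hJ hlen.1) 2
    linarith [hlen.2]
  · have hfin : ∀ᵐ t ∂(volume.restrict (Ioo 0 T)), Facet.normI (ut t) 2 < ⊤ :=
      Facet.ae_restrict_Ioo_zero fun δ hδ => by
        obtain ⟨C, hC⟩ := hu.ut_bound δ hδ
        exact hC.mono fun t ht => ht.trans_lt ENNReal.coe_lt_top
    filter_upwards [hgood, hfin, ae_restrict_mem measurableSet_Ioo] with t hg hn ht a b hab
    have htI : t ∈ Icc 0 T := Ioo_subset_Icc_self ht
    -- at almost every `t` the constant family of times `s = t` is admissible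
    have hpure : ∀ {P : ℝ → Prop}, P t → ∃ᶠ s in 𝓝[Icc 0 T] t, P s := fun hP =>
      (frequently_pure.2 hP).filter_mono (pure_le_nhdsWithin htI)
    refine ⟨?_, fun htop => ?_⟩
    · exact Facet.length_bound_of_frequently_two (M := (Facet.normI (ut t) 2).toNNReal)
        hL hJ hfc huc htI (hpure ⟨hg, (ENNReal.coe_toNNReal hn.ne).ge⟩) hab
    · exact Facet.length_bound_of_frequently_top (M := (Facet.normI (ut t) ⊤).toNNReal)
        hL hJ hfc huc htI (hpure ⟨hg, (ENNReal.coe_toNNReal htop.ne).ge⟩) hab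
  · intro t ht t₁ t₂ h₁ h₂ h₁₂ htt M a b hab
    exact ⟨fun hM => Facet.length_bound_of_frequently_two hL hJ hfc huc (hIcc t ht)
        (hnear t ht t₁ t₂ h₁ h₂ h₁₂ htt _ hM) hab,
      fun hM => Facet.length_bound_of_frequently_top hL hJ hfc huc (hIcc t ht)
        (hnear t ht t₁ t₂ h₁ h₂ h₁₂ htt _ hM) hab⟩
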